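/- Let $(A,\mu)$ be a (real, smooth, finite-rank) Lie algebroid over a smooth manifold $M$, with bracket $[\,,]^\mu$ and anchor $\rho$, and let $d_\mu$ and $\mathcal L^\mu$ be its differential and Lie derivative. Let $E=A\oplus A^*$ carry the canonical form $\langle X+\xi,Y+\eta\rangle=\langle\xi,Y\rangle+\langle\eta,X\rangle$, and let $\mathcal A=\bigoplus_k\mathcal A^k$ be the graded algebra of functions on the minimal symplectic realization $T^*[2]A[1]$ of $E$, with its Poisson bracket $\{\,,\}$ of degree $-2$, so that $\mathcal A^0=C^\infty(M)$, $\mathcal A^1=\Gamma(E)$ and $\{u,v\}=\langle u,v\rangle$ for $u,v\in\Gamma(E)$. View $\mu$ as the element of $\mathcal A^3$ with $\{\{u,\mu\},v\}=[u,v]$ and $\{\{u,\mu\},f\}=\rho(u)f$ for $u,v\in\Gamma(E)$, $f\in C^\infty(M)$, where $[X+\xi,Y+\eta]=[X,Y]^\mu+\mathcal L^\mu_X\eta-i_Yd_\mu\xi$ and $\rho(X+\xi)=\rho(X)$. For a skew-symmetric endomorphism $\mathcal N$ of $E$ let $\widetilde{\mathcal N}\in\mathcal A^2$ be the element with $\{u,\widetilde{\mathcal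 N}\}=\mathcal N u$ for all $u\in\Gamma(E)$. Given a Courant algebroid structure $\Theta$ on $E$, i.e. $\Theta\in\mathcal A^3$ with $\{\Theta,\Theta\}=0$, such an $\mathcal N$ is called a weak deforming tensor for $(E,\Theta)$ if $\{\Theta,\{\{\widetilde{\mathcal N},\Theta\},\widetilde{\mathcal N}\}\}=0$. Let $N$ be a vector bundle endomorphism of $A$ with transpose ${}^tN$, and let $\pi$ be a bivector on $A$, viewed as a skew-symmetric map $\pi:A^*\to A$, such that $N\pi=\pi\,{}^tN$. Suppose that $(\pi,N)$ is a Poisson–Nijenhuis structure on $(A,\mu)$; that is, with $[\xi,\eta]_\pi=\mathcal L^\mu_{\pi\xi}\eta-\mathcal L^\mu_{\pi\eta}\xi-d_\mu\langle\eta,\pi\xi\rangle$ for $\xi,\eta\in\Gamma(A^*)$: - $\pi$ is Poisson: the Schouten–Nijenhuis bracket $[\pi,\pi]^\mu$ vanishes, i.e. $[\pi\xi,\pi\eta]^\mu=\pi[\xi,\eta]_\pi$ for all $\xi,\eta$; - $N$ is Nijenhuis: $[NX,NY]^\mu=N\big([NX,Y]^\mu+[X,NY]^\mu-N[X,Y]^\mu\big)$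 for all $X,Y\in\Gamma(A)$; - $\pi$ and $N$ are compatible: $[\xi,\eta]_{N\pi}=[{}^tN\xi,\eta]_\pi+[\xi,{}^tN\eta]_\pi-{}^tN[\xi,\eta]_\pi$ for all $\xi,\eta$. Then $\mu$ is a Courant algebroid structure on $A\oplus A^*$, and the endomorphism $$\mathcal N=\begin{pmatrix}N&\pi\\0&-{}^tN\end{pmatrix}$$ of $A\oplus A^*$ is skew-symmetric and is a weak deforming tensor for $(A\oplus A^*,\mu)$. -/

import Mathlib

open scoped Manifold ContDiff

universe u

/-!
The setting is algebraic: `R` plays the role of `C^∞(M)`, a module `E` (or `L`) over `R` that of the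
sections of a vector bundle, and `Module.Dual R L` that of the sections of the dual bundle.
-/

namespace BigBracket

/-! ### The graded Poisson algebra of a vector bundle with a fibrewise symmetric bilinear form

Let `(E, ⟨ , ⟩)` be a vector bundle with a fibrewise nondegenerate symmetric bilinear form, and let
`𝒜 = ⨁ 𝒜^k` be the graded algebra of functions on its minimal symplectic realization, with its
Poisson bracket of degree `-2`; one has `𝒜^0 = R`, `𝒜^1 = E` and `{u, v} = ⟨u, v⟩`. In local
coordinates `(q^i, τ^a, p_i)`, of degrees `0, 1, 2`, a function of degree `k ≥ 2` all of whose
brackets with the `q^i` and the `τ^a` vanish is zero. So a function `φ` of degree `k ≥ 2` *is* the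
pair of maps `u ↦ {φ, u} ∈ 𝒜^(k-1)` and `f ↦ {φ, f} ∈ 𝒜^(k-2)`, and the pairs that occur are those
that satisfy the obvious necessary conditions, `IsFunction` below. -/

section PoissonAlgebra

variable {R E : Type u} [CommRing R] [Algebra ℝ R] [AddCommGroup E] [Module R E]

/-- Iterated pairs of maps `(u ↦ {φ, u}, f ↦ {φ, f})`, before any condition is imposed. -/
def Cochain (R E : Type u) : ℕ → Type u
  | 0 => R
  | 1 => E
  | k + 2 => (E → Cochain R E (k + 1)) × (R → Cochain R E k)

instance Cochain.instAddCommGroup : (k : ℕ) → AddCommGroup (Cochain R E k)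
  | 0 => inferInstanceAs (AddCommGroup R)
  | 1 => inferInstanceAs (AddCommGroup E)
  | k + 2 =>
    letI := Cochain.instAddCommGroup (k + 1)
    letI := Cochain.instAddCommGroup k
    inferInstanceAs (AddCommGroup ((E → Cochain R E (k + 1)) × (R → Cochain R E k)))

/-- Multiplication by functions of degree `0`; it is computed pointwise because `{f, u} = 0` and
`{f, g} = 0`. -/
instance Cochain.instModule : (k : ℕ) → Module R (Cochain R E k)
  | 0 => inferInstanceAs (Module R R)
  | 1 => inferInstanceAs (Module R E)
  | k + 2 =>
    letI := Cochain.instModule (k + 1)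
    letI := Cochain.instModule k
    inferInstanceAs (Module R ((E → Cochain R E (k + 1)) × (R → Cochain R E k)))

/-- `{φ, u}` for `φ` of degree `k + 1` and a section `u`. -/
def bracketSection (B : LinearMap.BilinForm R E) :
    (k : ℕ) → Cochain R E (k + 1) → E → Cochain R E k
  | 0, v, u => B v u
  | _ + 1, φ, u => φ.1 u

/-- `{φ, f}` for `φ` of degree `k + 2` and a function `f` of degree `0`. -/
def bracketScalar (k : ℕ) (φ : Cochain R E (k + 2)) (f : R) : Cochain R E k := φ.2 f

/-- `{{φ, u}, f} = {{φ, f}, u}`; there is nothing to say in degree `2`, where both sides have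
negative degree. -/
def CommSectionScalar (B : LinearMap.BilinForm R E) : (k : ℕ) → Cochain R E (k + 2) → Prop
  | 0, _ => True
  | k + 1, φ => ∀ u f, bracketScalar k (φ.1 u) f = bracketSection B k (φ.2 f) u

/-- `{{φ, f}, g} = {{φ, g}, f}`; there is nothing to say in degrees `2` and `3`. -/
def CommScalarScalar : (k : ℕ) → Cochain R E (k + 2) → Prop
  | 0, _ => True
  | 1, _ => True
  | k + 2, φ => ∀ f g, bracketScalar k (φ.2 f) g = bracketScalar k (φ.2 g) f

/-- The elements of `𝒜^k` among all iterated pairs of maps: `{φ, ·}` takes values in `𝒜`, it is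
`ℝ`-linear, it is a derivation on `R`, and it satisfies the graded Jacobi identity
`{{φ, x}, y} = {φ, {x, y}} + (-1)^(|x| |y|) {{φ, y}, x}` for `x`, `y` of degree `0` or `1`. -/
def IsFunction (B : LinearMap.BilinForm R E) : (k : ℕ) → Cochain R E k → Prop
  | 0, _ => True
  | 1, _ => True
  | k + 2, φ =>
    (∀ u, IsFunction B (k + 1) (φ.1 u)) ∧ (∀ f, IsFunction B k (φ.2 f)) ∧
    (∀ u v, φ.1 (u + v) = φ.1 u + φ.1 v) ∧
    (∀ (c : ℝ) u, φ.1 (algebraMap ℝ R c • u) = algebraMap ℝ R c • φ.1 u) ∧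
    (∀ f g, φ.2 (f + g) = φ.2 f + φ.2 g) ∧
    (∀ c : ℝ, φ.2 (algebraMap ℝ R c) = 0) ∧
    (∀ f g, φ.2 (f * g) = f • φ.2 g + g • φ.2 f) ∧
    (∀ u v, bracketSection B k (φ.1 u) v + bracketSection B k (φ.1 v) u = φ.2 (B u v)) ∧
    CommSectionScalar B k φ ∧ CommScalarScalar k φ

/-- The same element, with its degree written differently. -/
def Cochain.cast {p q : ℕ} (h : p = q) (φ : Cochain R E p) : Cochain R E q := h ▸ φ

/-- The Poisson bracket `{ , } : 𝒜^p × 𝒜^q → 𝒜^(p+q-2)`. If one argument has degree `0` or `1`, it is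
given by the graded skew-symmetry `{φ, ψ} = -(-1)^(p q) {ψ, φ}` and by the brackets with functions
and sections that are part of the data; otherwise it is determined by the graded Jacobi identity
`{{φ, ψ}, x} = {φ, {ψ, x}} + (-1)^(|ψ| |x|) {{φ, x}, ψ}`, where `x` is a section (of degree `1`) or a
function of degree `0`. -/
def poissonBracket (B : LinearMap.BilinForm R E) :
    (n p q : ℕ) → p + q = n + 2 → Cochain R E p → Cochain R E q → Cochain R E n
  | n, 0, _, h, f, ψ =>
    -bracketScalar n (Cochain.cast (by omega) ψ) f
  | n, 1, _, h, u, ψ =>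
    (-1 : ℤ) ^ n • bracketSection B n (Cochain.cast (by omega) ψ) u
  | n, p + 2, 0, h, φ, f =>
    bracketScalar n (Cochain.cast (p := p + 2) (by omega) φ) f
  | n, p + 2, 1, h, φ, u =>
    bracketSection B n (Cochain.cast (p := p + 2) (by omega) φ) u
  | 0, p + 2, q + 2, h, _, _ => absurd h (by omega)
  | 1, p + 2, q + 2, h, _, _ => absurd h (by omega)
  | n + 2, p + 2, q + 2, h, φ, ψ =>
    (fun u => poissonBracket B (n + 1) (p + 2) (q + 1) (by omega) φ (ψ.1 u) +
        (-1 : ℤ) ^ (q + 2) • poissonBracket B (n + 1) (p + 1) (q + 2) (by omega) (φ.1 u) ψ,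
      fun f => poissonBracket B n (p + 2) q (by omega) φ (ψ.2 f) +
        poissonBracket B n p (q + 2) (by omega) (φ.2 f) ψ)

/-- A Courant algebroid structure on `(E, ⟨ , ⟩)`: an element `Θ` of `𝒜^3` with `{Θ, Θ} = 0`. -/
def IsCourantStructure (B : LinearMap.BilinForm R E) (Θ : Cochain R E 3) : Prop :=
  IsFunction B 3 Θ ∧ poissonBracket B 4 3 3 rfl Θ Θ = 0

/-- `⟨𝒩 u, v⟩ + ⟨u, 𝒩 v⟩ = 0`. -/
def IsSkew (B : LinearMap.BilinForm R E) (𝒩 : E →ₗ[R] E) : Prop :=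
  ∀ u v, B (𝒩 u) v + B u (𝒩 v) = 0

/-- The element `𝒩~` of `𝒜^2` of a skew-symmetric endomorphism `𝒩`, the one with
`{u, 𝒩~} = 𝒩 u`, hence `{𝒩~, u} = -𝒩 u`, for all sections `u`, and `{𝒩~, f} = 0`. -/
def tilde (𝒩 : E →ₗ[R] E) : Cochain R E 2 := (fun u => -𝒩 u, fun _ => (0 : R))

/-- `𝒩` is a weak deforming tensor for `Θ`: it is skew-symmetric and `{{𝒩~, Θ}, 𝒩~}` is a cocycle
of `d_Θ = {Θ, ·}`. -/
def IsWeakDeforming (B : LinearMap.BilinForm R E) (Θ : Cochain R E 3) (𝒩 : E →ₗ[R] E) : Prop :=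
  IsSkew B 𝒩 ∧
    poissonBracket B 4 3 3 rfl Θ
      (poissonBracket B 3 3 2 rfl (poissonBracket B 3 2 3 rfl (tilde 𝒩) Θ) (tilde 𝒩)) = 0

end PoissonAlgebra

/-! ### Lie algebroids -/

/-- A Lie algebroid structure on the module `L` of sections of a vector bundle: a Lie bracket and an
`R`-linear anchor with values in the vector fields, that is, the derivations of `R`. -/
structure LieAlgebroid (R L : Type*) [CommRing R] [Algebra ℝ R] [AddCommGroup L] [Module R L] where
  bracket : L → L → L
  anchor : L →ₗ[R] Derivation ℝ R R
  bracket_add : ∀ X Y Z, bracket X (Y + Z) = bracket X Y + bracket X Z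
  bracket_skew : ∀ X Y, bracket X Y = -bracket Y X
  jacobi : ∀ X Y Z,
    bracket X (bracket Y Z) = bracket (bracket X Y) Z + bracket Y (bracket X Z)
  leibniz : ∀ X (f : R) Y, bracket X (f • Y) = f • bracket X Y + anchor X f • Y
  anchor_bracket : ∀ X Y f,
    anchor (bracket X Y) f = anchor X (anchor Y f) - anchor Y (anchor X f)

namespace LieAlgebroid

section

variable {R L : Type*} [CommRing R] [Algebra ℝ R] [AddCommGroup L] [Module R L]
  (μ : LieAlgebroid R L)

/-- The differential `d_μ f` of a function, `⟨d_μ f, X⟩ = ρ(X) f`. -/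
def d (f : R) : Module.Dual R L where
  toFun X := μ.anchor X f
  map_add' X Y := by simp
  map_smul' g X := by simp

/-- The Lie derivative of a form, `⟨ℒ_X η, Y⟩ = ρ(X) ⟨η, Y⟩ - ⟨η, [X, Y]⟩`. -/
def lieDeriv (X : L) (η : Module.Dual R L) : Module.Dual R L where
  toFun Y := μ.anchor X (η Y) - η (μ.bracket X Y)
  map_add' Y Z := by simp only [map_add, μ.bracket_add]; abel
  map_smul' g Y := by
    simp only [map_smul, μ.leibniz, map_add, smul_eq_mul, Derivation.leibniz, RingHom.id_apply]
    ring

/-- The Nijenhuis torsion of an endomorphism. -/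
def torsion (N : L →ₗ[R] L) (X Y : L) : L :=
  μ.bracket (N X) (N Y) -
    N (μ.bracket (N X) Y + μ.bracket X (N Y) - N (μ.bracket X Y))

/-- The bracket of forms defined by a bivector,
`[ξ, η]_π = ℒ_{π ξ} η - ℒ_{π η} ξ - d_μ ⟨η, π ξ⟩`. -/
def formBracket (π : Module.Dual R L →ₗ[R] L) (ξ η : Module.Dual R L) : Module.Dual R L :=
  μ.lieDeriv (π ξ) η - μ.lieDeriv (π η) ξ - μ.d (η (π ξ))

/-- Half of the Schouten bracket `[π, π]^μ` of a bivector with itself, as a map from pairs of forms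
to sections: `[π ξ, π η] - π [ξ, η]_π`. -/
def halfSchouten (π : Module.Dual R L →ₗ[R] L) (ξ η : Module.Dual R L) : L :=
  μ.bracket (π ξ) (π η) - π (μ.formBracket π ξ η)

end

end LieAlgebroid

/-- A bivector, viewed as a skew-symmetric map from the dual. -/
def IsBivector {R L : Type*} [CommRing R] [AddCommGroup L] [Module R L]
    (π : Module.Dual R L →ₗ[R] L) : Prop :=
  ∀ ξ η : Module.Dual R L, ξ (π η) = -η (π ξ)

/-- A Poisson-Nijenhuis structure on a Lie algebroid: a Poisson bivector `π` and a Nijenhuis tensor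
`N` that are compatible, `N π = π ᵗN` and `[ξ, η]_{N π} = [ᵗN ξ, η]_π + [ξ, ᵗN η]_π - ᵗN [ξ, η]_π`. -/
structure IsPoissonNijenhuis {R L : Type*} [CommRing R] [Algebra ℝ R] [AddCommGroup L] [Module R L]
    (μ : LieAlgebroid R L) (π : Module.Dual R L →ₗ[R] L) (N : L →ₗ[R] L) : Prop where
  bivector : IsBivector π
  poisson : ∀ ξ η, μ.halfSchouten π ξ η = 0
  nijenhuis : ∀ X Y, μ.torsion N X Y = 0
  comm : N ∘ₗ π = π ∘ₗ N.dualMap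
  compatible : ∀ ξ η : Module.Dual R L,
    μ.formBracket (N ∘ₗ π) ξ η =
      μ.formBracket π (N.dualMap ξ) η + μ.formBracket π ξ (N.dualMap η) -
        N.dualMap (μ.formBracket π ξ η)

/-! ### The double of the trivial Lie bialgebroid of a Lie algebroid -/

section Double

variable {R L : Type u} [CommRing R] [Algebra ℝ R] [AddCommGroup L] [Module R L]

/-- The canonical symmetric bilinear form of `A ⊕ A*`, `⟨X + ξ, Y + η⟩ = ⟨ξ, Y⟩ + ⟨η, X⟩`. -/
def pairing (R L : Type u) [CommRing R] [AddCommGroup L] [Module R L] :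
    LinearMap.BilinForm R (L × Module.Dual R L) :=
  LinearMap.mk₂ R (fun u v => u.2 v.1 + v.2 u.1)
    (fun u u' v => by simp; ring) (fun c u v => by simp; ring)
    (fun u v v' => by simp; ring) (fun c u v => by simp; ring)

/-- The Dorfman bracket of the double of `((A, μ), (A*, 0))`,
`[X + ξ, Y + η] = [X, Y] + ℒ_X η - i_Y d_μ ξ`, where `i_Y d_μ ξ = ℒ_Y ξ - d_μ ⟨ξ, Y⟩`. -/
def dorfman (μ : LieAlgebroid R L) (u v : L × Module.Dual R L) : L × Module.Dual R L :=
  (μ.bracket u.1 v.1, μ.lieDeriv u.1 v.2 - (μ.lieDeriv v.1 u.2 - μ.d (u.2 v.1)))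

/-- The Lie algebroid structure `μ`, as an element of `𝒜^3` for `A ⊕ A*`. It is the function whose
derived brackets are the Dorfman bracket, `{{u, μ}, v} = [u, v]`, and the anchor,
`{{u, μ}, f} = ρ(X) f` for `u = X + ξ`; here `{u, μ} = {μ, u}`, and `{μ, f} = d_μ f`. -/
def LieAlgebroid.toFunction (μ : LieAlgebroid R L) : Cochain R (L × Module.Dual R L) 3 :=
  (fun u => ((fun v => dorfman μ u v, fun f => μ.anchor u.1 f) :
      Cochain R (L × Module.Dual R L) 2),
    fun f => ((0, μ.d f) : L × Module.Dual R L))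

/-- The endomorphism of `A ⊕ A*` with matrix `(N, π; 0, -ᵗN)`. -/
def doubleEndo (N : L →ₗ[R] L) (π : Module.Dual R L →ₗ[R] L) :
    L × Module.Dual R L →ₗ[R] L × Module.Dual R L :=
  (N.coprod π).prod (-(N.dualMap ∘ₗ LinearMap.snd R L (Module.Dual R L)))

end Double

/-! ### Sections of smooth vector bundles -/

section Sections

variable {EM : Type*} [NormedAddCommGroup EM] [NormedSpace ℝ EM]
  {M : Type*} [TopologicalSpace M] [ChartedSpace EM M]
  {F : Type*} [NormedAddCommGroup F] [NormedSpace ℝ F]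
  {A : M → Type*} [TopologicalSpace (Bundle.TotalSpace F A)]
  [∀ x, TopologicalSpace (A x)] [FiberBundle F A]
  [∀ x, AddCommGroup (A x)] [∀ x, Module ℝ (A x)] [VectorBundle ℝ F A]

/-- Smooth sections form a module over the smooth functions. -/
noncomputable instance instModuleSections :
    Module C^∞⟮𝓘(ℝ, EM), M; 𝓘(ℝ, ℝ), ℝ⟯ Cₛ^∞⟮𝓘(ℝ, EM); F, A⟯ where
  smul f s := ⟨fun x => f x • s x, f.contMDiff.smul_section s.contMDiff⟩
  one_smul s := by ext x; exact one_smul ℝ (s x)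
  mul_smul f g s := by ext x; exact mul_smul (f x) (g x) (s x)
  smul_zero f := by ext x; exact smul_zero (f x)
  smul_add f s t := by ext x; exact smul_add (f x) (s x) (t x)
  add_smul f g s := by ext x; exact add_smul (f x) (g x) (s x)
  zero_smul s := by ext x; exact zero_smul ℝ (s x)

end Sections

end BigBracket

open BigBracket

/-! With `[ , ]` the Dorfman bracket, `{μ, μ} = 0` expresses its Jacobi identity and the rules for
exact forms, all consequences of the Lie algebroid axioms. For weak deformation the point is that
`{{𝒩~, μ}, 𝒩~}` is a coboundary: it equals `{μ, S~}` with `S = diag(N², -ᵗN²)`, and `{μ, {μ, S~}} =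
½ {{μ, μ}, S~} = 0`.

Indeed `-{{𝒩~, μ}, 𝒩~}` has the bracket `2 T(u, v) + [𝒩²u, v] + [u, 𝒩²v] - 𝒩²[u, v]`, with `T` the
torsion of `𝒩`, and `𝒩² = diag(N², ᵗN²)` because `Nπ = π ᵗN`. Its difference from the bracket
deformed once by `S` is a combination of the torsion of `N`, the Schouten bracket of `π` and the
concomitant of `π` and `N`, all zero (`IsPoissonNijenhuis.deformed_deformed_eq`). The cocycle
condition is then checked on components (`isWeakDeforming_of_deformed_eq`). Identities between
sections are tested against forms, which separate sections thanks to bump functions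
(`section_eq_zero_of_forall_dual`). -/

namespace BigBracket

/-! ### Poisson brackets of functions of degree 2 and 3 in components -/

section Components

variable {R E : Type u} [CommRing R] [AddCommGroup E] [Module R E]

/-- The pair of maps of degree `3` with brackets `{{φ, u}, v} = b u v`, `{{φ, u}, f} = ρ u f` and
`{φ, f} = d f`. -/
def cochainOfBracket (b : E → E → E) (ρ : E → R → R) (d : R → E) : Cochain R E 3 :=
  (fun u => ((b u, ρ u) : Cochain R E 2), d)

/-- The maps `ρ` and `d` are arbitrary here, so the brackets with `{S~, f} = 0` leave the terms `ρ u
0` and `d 0`. -/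
theorem poissonBracket_tilde_cochainOfBracket (B : LinearMap.BilinForm R E) (S : E →ₗ[R] E)
    (b : E → E → E) (ρ : E → R → R) (d : R → E) :
    poissonBracket B 3 2 3 rfl (tilde S) (cochainOfBracket b ρ d) =
      cochainOfBracket (fun u v => -S (b u v) - b u (-S v) - b (-S u) v)
        (fun u f => -ρ u 0 - ρ (-S u) f) (fun f => -S (d f) - d 0) := by
  refine Prod.ext (funext fun u => ?_) (funext fun f => ?_)
  · refine Prod.ext (funext fun v => ?_) (funext fun f => ?_)
    -- The recursion unfolds definitionally. The outer signs, `(-1) ^ 3` and the first `(-1) ^ 2`,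
    -- come from the Jacobi rule, the exponent being the degree of the second argument; the inner
    -- ones come from moving a section across, the exponent being the degree of the result.
    · change (-S (b u v) + (-1 : ℤ) ^ 2 • ((-1 : ℤ) ^ 1 • b u (-S v))) +
        (-1 : ℤ) ^ 3 • ((-1 : ℤ) ^ 2 • b (-S u) v) = -S (b u v) - b u (-S v) - b (-S u) v
      module
    · change ((0 : R) + -ρ u 0) + (-1 : ℤ) ^ 3 • ((-1 : ℤ) ^ 2 • ρ (-S u) f) =
        -ρ u 0 - ρ (-S u) f
      module
  · exact (sub_eq_add_neg (-S (d f)) (d 0)).symm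

theorem poissonBracket_cochainOfBracket_tilde (B : LinearMap.BilinForm R E) (S : E →ₗ[R] E)
    (b : E → E → E) (ρ : E → R → R) (d : R → E) :
    poissonBracket B 3 3 2 rfl (cochainOfBracket b ρ d) (tilde S) =
      cochainOfBracket (fun u v => b (-S u) v + b u (-S v) + S (b u v))
        (fun u f => ρ (-S u) f + ρ u 0) (fun f => d 0 + S (d f)) := by
  refine Prod.ext (funext fun u => ?_) (funext fun f => ?_)
  · refine Prod.ext (funext fun v => ?_) (funext fun f => ?_)
    · change b (-S u) v + (-1 : ℤ) ^ 2 • (b u (-S v) + (-1 : ℤ) ^ 2 • ((-1 : ℤ) ^ 1 • -S (b u v))) =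
        b (-S u) v + b u (-S v) + S (b u v)
      module
    · change ρ (-S u) f + (-1 : ℤ) ^ 2 • (ρ u 0 + -(0 : R)) = ρ (-S u) f + ρ u 0
      module
  · change d 0 + (-1 : ℤ) ^ 1 • -S (d f) = d 0 + S (d f)
    module

/-- The components of `{φ, ψ}` for `φ` and `ψ` of degree `3`. -/
theorem poissonBracket_cochainOfBracket_eq_zero (B : LinearMap.BilinForm R E)
    {b b' : E → E → E} {ρ ρ' : E → R → R} {d d' : R → E}
    (h_jacobi : ∀ u v w, b u (b' v w) + b' u (b v w) =
      b (b' u v) w + b' (b u v) w + b v (b' u w) + b' v (b u w))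
    (h_anchor : ∀ u v f, ρ (b' u v) f + ρ' (b u v) f =
      ρ u (ρ' v f) + ρ' u (ρ v f) - ρ v (ρ' u f) - ρ' v (ρ u f))
    (h_bracket_d : ∀ u f, b u (d' f) + b' u (d f) = d (ρ' u f) + d' (ρ u f))
    (h_d_bracket : ∀ f v, b (d' f) v + b' (d f) v = 0)
    (h_anchor_d : ∀ f g, ρ (d' f) g + ρ' (d f) g = 0) :
    poissonBracket B 4 3 3 rfl (cochainOfBracket b ρ d) (cochainOfBracket b' ρ' d') = 0 := by
  refine Prod.ext (funext fun u => ?_) (funext fun f => ?_)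
  · refine Prod.ext (funext fun v => ?_) (funext fun f => ?_)
    · refine Prod.ext (funext fun w => ?_) (funext fun f => ?_)
      · change (b (b' u v) w + (-1 : ℤ) ^ 2 • (b v (b' u w) +
            (-1 : ℤ) ^ 2 • ((-1 : ℤ) ^ 1 • b' u (b v w)))) +
          (-1 : ℤ) ^ 3 • ((b u (b' v w) + (-1 : ℤ) ^ 2 • ((-1 : ℤ) ^ 1 • b' v (b u w))) +
            (-1 : ℤ) ^ 3 • ((-1 : ℤ) ^ 2 • b' (b u v) w)) = 0
        linear_combination (norm := module) -h_jacobi u v w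
      · change (ρ (b' u v) f + (-1 : ℤ) ^ 2 • (ρ v (ρ' u f) + -ρ' u (ρ v f))) +
          (-1 : ℤ) ^ 3 • ((ρ u (ρ' v f) + -ρ' v (ρ u f)) +
            (-1 : ℤ) ^ 3 • ((-1 : ℤ) ^ 2 • ρ' (b u v) f)) = 0
        linear_combination h_anchor u v f
    · change (d (ρ' u f) + (-1 : ℤ) ^ 1 • b' u (d f)) +
        (-1 : ℤ) ^ 3 • (b u (d' f) + -d' (ρ u f)) = 0
      linear_combination (norm := module) -h_bracket_d u f
  · refine Prod.ext (funext fun v => ?_) (funext fun g => ?_)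
    · change b (d' f) v + (-1 : ℤ) ^ 2 • b' (d f) v = 0
      linear_combination (norm := module) h_d_bracket f v
    · change ρ (d' f) g + (-1 : ℤ) ^ 2 • ρ' (d f) g = 0
      linear_combination h_anchor_d f g

end Components

theorem pairing_apply {R L : Type u} [CommRing R] [AddCommGroup L] [Module R L]
    (u v : L × Module.Dual R L) : pairing R L u v = u.2 v.1 + v.2 u.1 := rfl

/-! ### The Dorfman bracket, the Courant structure and the cocycle criterion -/

section Double

variable {R L : Type u} [CommRing R] [Algebra ℝ R] [AddCommGroup L] [Module R L]
  (μ : LieAlgebroid R L)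

namespace LieAlgebroid

theorem add_bracket (X Y Z : L) : μ.bracket (X + Y) Z = μ.bracket X Z + μ.bracket Y Z := by
  rw [μ.bracket_skew, μ.bracket_add, μ.bracket_skew Z X, μ.bracket_skew Z Y]; abel

theorem bracket_zero (X : L) : μ.bracket X 0 = 0 := by
  simpa using μ.bracket_add X 0 0

theorem bracket_neg (X Y : L) : μ.bracket X (-Y) = -μ.bracket X Y := by
  rw [eq_neg_iff_add_eq_zero, ← μ.bracket_add, neg_add_cancel, μ.bracket_zero]

theorem zero_bracket (X : L) : μ.bracket 0 X = 0 := by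
  rw [μ.bracket_skew, μ.bracket_zero, neg_zero]

theorem neg_bracket (X Y : L) : μ.bracket (-X) Y = -μ.bracket X Y := by
  rw [μ.bracket_skew, μ.bracket_neg, μ.bracket_skew X Y]

@[simp] theorem d_apply (f : R) (X : L) : μ.d f X = μ.anchor X f := rfl

@[simp] theorem lieDeriv_apply (X Y : L) (η : Module.Dual R L) :
    μ.lieDeriv X η Y = μ.anchor X (η Y) - η (μ.bracket X Y) := rfl

theorem bracket_smul_const (c : ℝ) (X Y : L) :
    μ.bracket X (algebraMap ℝ R c • Y) = algebraMap ℝ R c • μ.bracket X Y := by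
  rw [μ.leibniz, Derivation.map_algebraMap, zero_smul, add_zero]

theorem smul_bracket (f : R) (X Y : L) :
    μ.bracket (f • X) Y = f • μ.bracket X Y - μ.anchor Y f • X := by
  rw [μ.bracket_skew, μ.leibniz, μ.bracket_skew Y X]; module

end LieAlgebroid

theorem dorfman_add (u v w : L × Module.Dual R L) :
    dorfman μ u (v + w) = dorfman μ u v + dorfman μ u w := by
  refine Prod.ext (μ.bracket_add _ _ _) (LinearMap.ext fun Z => ?_)
  simp [dorfman, μ.add_bracket]; ring

theorem add_dorfman (u v w : L × Module.Dual R L) :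
    dorfman μ (u + v) w = dorfman μ u w + dorfman μ v w := by
  refine Prod.ext (μ.add_bracket _ _ _) (LinearMap.ext fun Z => ?_)
  simp [dorfman, μ.add_bracket]; ring

theorem neg_dorfman (u v : L × Module.Dual R L) : dorfman μ (-u) v = -dorfman μ u v := by
  refine Prod.ext (μ.neg_bracket _ _) (LinearMap.ext fun Z => ?_)
  simp [dorfman, μ.neg_bracket]; ring

theorem dorfman_neg (u v : L × Module.Dual R L) : dorfman μ u (-v) = -dorfman μ u v := by
  refine Prod.ext (μ.bracket_neg _ _) (LinearMap.ext fun Z => ?_)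
  simp [dorfman, μ.neg_bracket]; ring

theorem dorfman_sub (u v w : L × Module.Dual R L) :
    dorfman μ u (v - w) = dorfman μ u v - dorfman μ u w := by
  rw [sub_eq_add_neg, dorfman_add, dorfman_neg, sub_eq_add_neg]

theorem sub_dorfman (u v w : L × Module.Dual R L) :
    dorfman μ (u - v) w = dorfman μ u w - dorfman μ v w := by
  rw [sub_eq_add_neg, add_dorfman, neg_dorfman, sub_eq_add_neg]

/-- In the form part, paired with `Z`, the iterated anchors cancel. What remains is, for each of the
three forms, the Jacobi identity of the other two sections and `Z`. -/
theorem dorfman_jacobi (u v w : L × Module.Dual R L) :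
    dorfman μ u (dorfman μ v w) =
      dorfman μ (dorfman μ u v) w + dorfman μ v (dorfman μ u w) := by
  refine Prod.ext (μ.jacobi _ _ _) (LinearMap.ext fun Z => ?_)
  simp only [dorfman, LinearMap.sub_apply, LieAlgebroid.lieDeriv_apply, LieAlgebroid.d_apply,
    map_sub, Prod.snd_add, LinearMap.add_apply, μ.anchor_bracket]
  have h₁ := μ.jacobi u.1 v.1 Z
  have h₂ := μ.jacobi u.1 w.1 Z
  have h₃ := μ.jacobi v.1 w.1 Z
  have h₁' := congrArg w.2 h₁
  have h₂' := congrArg v.2 h₂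
  have h₃' := congrArg u.2 h₃
  simp only [map_add] at h₁' h₂' h₃'
  linear_combination -h₁' + h₂' - h₃'

theorem dorfman_d (u : L × Module.Dual R L) (f : R) :
    dorfman μ u (0, μ.d f) = (0, μ.d (μ.anchor u.1 f)) := by
  refine Prod.ext (μ.bracket_zero _) (LinearMap.ext fun Z => ?_)
  simp [dorfman, μ.zero_bracket, μ.anchor_bracket]

/-- This is `d_μ ∘ d_μ = 0` on functions: the anchor preserves brackets. -/
theorem d_dorfman (f : R) (u : L × Module.Dual R L) : dorfman μ (0, μ.d f) u = 0 := by
  refine Prod.ext (μ.zero_bracket _) (LinearMap.ext fun Z => ?_)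
  simp [dorfman, μ.zero_bracket, μ.anchor_bracket]

theorem dorfman_add_swap (u v : L × Module.Dual R L) :
    dorfman μ u v + dorfman μ v u = (0, μ.d (pairing R L u v)) := by
  refine Prod.ext ?_ (LinearMap.ext fun Z => ?_)
  · simp [dorfman, μ.bracket_skew u.1 v.1]
  · simp [dorfman, pairing_apply]; ring

theorem pairing_dorfman (u v w : L × Module.Dual R L) :
    pairing R L (dorfman μ u v) w + pairing R L (dorfman μ u w) v =
      μ.anchor u.1 (pairing R L v w) := by
  simp [dorfman, pairing_apply, μ.bracket_skew w.1 v.1]; ring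

theorem dorfman_smul_const (c : ℝ) (u v : L × Module.Dual R L) :
    dorfman μ u (algebraMap ℝ R c • v) = algebraMap ℝ R c • dorfman μ u v := by
  refine Prod.ext (μ.bracket_smul_const _ _ _) (LinearMap.ext fun Z => ?_)
  simp [dorfman, μ.smul_bracket, Algebra.smul_def]; ring

theorem smul_const_dorfman (c : ℝ) (u v : L × Module.Dual R L) :
    dorfman μ (algebraMap ℝ R c • u) v = algebraMap ℝ R c • dorfman μ u v := by
  refine Prod.ext ?_ (LinearMap.ext fun Z => ?_)
  · simp [dorfman, μ.smul_bracket]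
  · simp [dorfman, μ.smul_bracket, Algebra.smul_def]; ring

/-- The graded Jacobi conditions are Courant axioms: invariance of the pairing (`pairing_dorfman`)
and the symmetric part of the bracket (`dorfman_add_swap`). -/
theorem isFunction_toFunction : IsFunction (pairing R L) 3 μ.toFunction := by
  refine ⟨fun u => ⟨fun _ => trivial, fun _ => trivial, dorfman_add μ u,
      fun c v => dorfman_smul_const μ c u v, fun f g => map_add (μ.anchor u.1) f g,
      fun c => (μ.anchor u.1).map_algebraMap c, (μ.anchor u.1).leibniz,
      pairing_dorfman μ u, trivial, trivial⟩, fun _ => trivial,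
    fun u v => ?_, fun c u => ?_, fun f g => ?_, fun c => ?_, fun f g => ?_,
    dorfman_add_swap μ, fun u f => ?_, trivial⟩
  · refine Prod.ext (funext fun w => add_dorfman μ u v w) (funext fun f => ?_)
    change μ.anchor (u.1 + v.1) f = μ.anchor u.1 f + μ.anchor v.1 f
    rw [map_add, Derivation.add_apply]
  · refine Prod.ext (funext fun w => smul_const_dorfman μ c u w) (funext fun f => ?_)
    change μ.anchor (algebraMap ℝ R c • u.1) f = algebraMap ℝ R c • μ.anchor u.1 f
    rw [map_smul, Derivation.smul_apply]
  · refine Prod.ext (add_zero (0 : L)).symm (LinearMap.ext fun Z => ?_)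
    exact map_add (μ.anchor Z) f g
  · refine Prod.ext rfl (LinearMap.ext fun Z => ?_)
    exact Derivation.map_algebraMap _ c
  · change ((0, μ.d (f * g)) : L × Module.Dual R L) =
      f • ((0, μ.d g) : L × Module.Dual R L) + g • ((0, μ.d f) : L × Module.Dual R L)
    refine Prod.ext (by simp) (LinearMap.ext fun Z => ?_)
    simp
  · change μ.anchor u.1 f = pairing R L (0, μ.d f) u
    simp [pairing_apply]

theorem toFunction_eq : μ.toFunction =
    cochainOfBracket (dorfman μ) (fun u f => μ.anchor u.1 f) (fun f => (0, μ.d f)) := rfl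

theorem isCourantStructure_toFunction : IsCourantStructure (pairing R L) μ.toFunction := by
  refine ⟨isFunction_toFunction μ, ?_⟩
  rw [toFunction_eq]
  refine poissonBracket_cochainOfBracket_eq_zero _ (fun u v w => ?_) (fun u v f => ?_)
    (fun u f => ?_) (fun f v => ?_) (fun f g => ?_)
  · rw [dorfman_jacobi μ u v w]; abel
  · simp only [dorfman, μ.anchor_bracket]; ring
  · simp only [dorfman_d]
  · simp only [d_dorfman, add_zero]
  · simp

theorem d_zero_prod : ((0, μ.d 0) : L × Module.Dual R L) = 0 :=
  Prod.ext rfl (LinearMap.ext fun Z => by simp)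

/-- `{{S~, μ}, S~}` is minus the structure `μ` deformed twice by `S`. -/
theorem poissonBracket_poissonBracket_tilde_toFunction
    (S : L × Module.Dual R L →ₗ[R] L × Module.Dual R L) :
    poissonBracket (pairing R L) 3 3 2 rfl
        (poissonBracket (pairing R L) 3 2 3 rfl (tilde S) μ.toFunction) (tilde S) =
      cochainOfBracket
        (fun u v => -(dorfman μ (S (S u)) v + dorfman μ u (S (S v)) + S (S (dorfman μ u v)) +
          2 • (dorfman μ (S u) (S v) - S (dorfman μ (S u) v) - S (dorfman μ u (S v)))))
        (fun u f => -μ.anchor (S (S u)).1 f) (fun f => -S (S (0, μ.d f))) := by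
  rw [toFunction_eq, poissonBracket_tilde_cochainOfBracket, poissonBracket_cochainOfBracket_tilde]
  congr 1
  · funext u v
    simp only [map_neg, dorfman_neg, neg_dorfman, map_sub]; module
  · funext u f
    simp
  · funext f
    simp [d_zero_prod]

/-- If deforming twice by `𝒩` amounts to deforming once by some `S`, then `{{𝒩~, μ}, 𝒩~}` is a
cocycle. -/
theorem isWeakDeforming_of_deformed_eq (𝒩 S : L × Module.Dual R L →ₗ[R] L × Module.Dual R L)
    (hskew : IsSkew (pairing R L) 𝒩)
    (h : ∀ u v, dorfman μ (𝒩 (𝒩 u)) v + dorfman μ u (𝒩 (𝒩 v)) + 𝒩 (𝒩 (dorfman μ u v)) +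
        2 • (dorfman μ (𝒩 u) (𝒩 v) - 𝒩 (dorfman μ (𝒩 u) v) - 𝒩 (dorfman μ u (𝒩 v))) =
      dorfman μ (S u) v + dorfman μ u (S v) - S (dorfman μ u v))
    (h_fst : ∀ u, (𝒩 (𝒩 u)).1 = (S u).1)
    (h_form : ∀ ξ : Module.Dual R L, 𝒩 (𝒩 (0, ξ)) = -S (0, ξ)) :
    IsWeakDeforming (pairing R L) μ.toFunction 𝒩 := by
  refine ⟨hskew, ?_⟩
  rw [poissonBracket_poissonBracket_tilde_toFunction, toFunction_eq]
  -- The second argument now has exactly the components of `{μ, S~}`.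
  simp only [h, h_fst, h_form, neg_neg]
  refine poissonBracket_cochainOfBracket_eq_zero _ (fun u v w => ?_) (fun u v f => ?_)
    (fun u f => ?_) (fun f v => ?_) (fun f g => ?_)
  -- The Jacobi identity with `S` inserted in each of the three slots, and once outside.
  · have h₄ := congrArg S (dorfman_jacobi μ u v w)
    simp only [dorfman_neg, neg_dorfman, dorfman_add, dorfman_sub, add_dorfman, sub_dorfman,
      map_add, dorfman_jacobi μ (S u) v w, dorfman_jacobi μ u (S v) w,
      dorfman_jacobi μ u v (S w)] at h₄ ⊢
    rw [h₄]
    abel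
  · simp only [dorfman, Prod.fst_neg, Prod.fst_add, Prod.fst_sub, map_neg, map_add, map_sub,
      Derivation.neg_apply, Derivation.add_apply, Derivation.sub_apply, μ.anchor_bracket]
    ring
  · have h₁ : ((0, μ.d (-μ.anchor (S u).1 f)) : L × Module.Dual R L) =
        -(0, μ.d (μ.anchor (S u).1 f)) := Prod.ext (by simp) (LinearMap.ext fun Z => by simp)
    simp only [h₁, dorfman_d]
    abel
  · simp only [d_dorfman, map_zero]
    abel
  · simp

end Double

/-! ### Consequences of the Poisson-Nijenhuis conditions -/

section PoissonNijenhuis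

variable {R L : Type u} [CommRing R] [AddCommGroup L] [Module R L]
  {N : L →ₗ[R] L} {π : Module.Dual R L →ₗ[R] L}

theorem doubleEndo_apply (u : L × Module.Dual R L) :
    doubleEndo N π u = (N u.1 + π u.2, -(N.dualMap u.2)) := rfl

theorem isSkew_doubleEndo (hπ : IsBivector π) : IsSkew (pairing R L) (doubleEndo N π) := by
  intro u v
  simp only [doubleEndo_apply, pairing_apply, map_add, LinearMap.neg_apply,
    LinearMap.dualMap_apply, hπ u.2 v.2]
  ring

variable [Algebra ℝ R] {μ : LieAlgebroid R L}

theorem IsPoissonNijenhuis.map_map (h : IsPoissonNijenhuis μ π N) (ξ : Module.Dual R L) :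
    N (π ξ) = π (N.dualMap ξ) :=
  congrArg (· ξ) h.comm

theorem IsPoissonNijenhuis.bivector_map (h : IsPoissonNijenhuis μ π N) (ξ η : Module.Dual R L) :
    ξ (N (π η)) = -η (N (π ξ)) := by
  rw [← LinearMap.dualMap_apply, h.bivector, h.map_map]

/-- The compatibility of `π` and `N`, as the vanishing of a map from pairs of forms to forms. -/
theorem IsPoissonNijenhuis.concomitant_forms (h : IsPoissonNijenhuis μ π N)
    (ξ η : Module.Dual R L) (Z : L) :
    μ.anchor (N Z) (η (π ξ)) - μ.anchor Z (η (N (π ξ))) + η (μ.bracket (π ξ) (N Z)) -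
      η (N (μ.bracket (π ξ) Z)) + ξ (N (μ.bracket (π η) Z)) - ξ (μ.bracket (π η) (N Z)) = 0 := by
  have := congrArg (· Z) (h.compatible ξ η)
  simp only [LieAlgebroid.formBracket, LinearMap.sub_apply, LinearMap.add_apply,
    LinearMap.comp_apply, LieAlgebroid.lieDeriv_apply, LieAlgebroid.d_apply,
    LinearMap.dualMap_apply, ← h.map_map] at this
  linear_combination -this

/-- The compatibility of `π` and `N`, as the vanishing of a map from sections and forms to
sections. -/
theorem IsPoissonNijenhuis.concomitant_sections (h : IsPoissonNijenhuis μ π N)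
    (hsep : ∀ X : L, (∀ ξ : Module.Dual R L, ξ X = 0) → X = 0) (X : L) (η : Module.Dual R L) :
    μ.bracket (N X) (π η) - π (μ.lieDeriv (N X) η) - N (μ.bracket X (π η)) +
      π (μ.lieDeriv X (N.dualMap η)) = 0 := by
  -- Skew-symmetry of `π` turns the pairing of `ξ` with `π (ℒ_X η)` into `-ℒ_X η` evaluated at `π
  -- ξ`, so the form version applies.
  refine hsep _ fun ξ => ?_
  have := h.concomitant_forms ξ η X
  simp only [map_add, map_sub, h.bivector ξ (μ.lieDeriv _ _), LieAlgebroid.lieDeriv_apply,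
    LinearMap.dualMap_apply, μ.bracket_skew (π _) _, map_neg] at this ⊢
  linear_combination this

/-- The section part of the difference is twice the torsion at `(X, Y)`, plus half the Schouten
bracket at `(ξ, η)`, plus the concomitant at `(X, η)`, minus that at `(Y, ξ)`. The form part, at
`Z`, pairs `η` and `ξ` with the torsions at `(X, Z)` and `(Y, Z)` and adds the concomitant of `ξ,
η`. -/
theorem IsPoissonNijenhuis.deformed_deformed_eq (h : IsPoissonNijenhuis μ π N)
    (hsep : ∀ X : L, (∀ ξ : Module.Dual R L, ξ X = 0) → X = 0) (u v : L × Module.Dual R L) :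
    dorfman μ (doubleEndo N π (doubleEndo N π u)) v +
        dorfman μ u (doubleEndo N π (doubleEndo N π v)) +
        doubleEndo N π (doubleEndo N π (dorfman μ u v)) +
        2 • (dorfman μ (doubleEndo N π u) (doubleEndo N π v) -
          doubleEndo N π (dorfman μ (doubleEndo N π u) v) -
          doubleEndo N π (dorfman μ u (doubleEndo N π v))) =
      dorfman μ (doubleEndo (N ∘ₗ N) 0 u) v + dorfman μ u (doubleEndo (N ∘ₗ N) 0 v) -
        doubleEndo (N ∘ₗ N) 0 (dorfman μ u v) := by
  obtain ⟨X, ξ⟩ := u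
  obtain ⟨Y, η⟩ := v
  refine Prod.ext (sub_eq_zero.1 (hsep _ fun ζ => ?_)) (LinearMap.ext fun Z => ?_)
  · have h₁ := congrArg ζ (h.nijenhuis X Y)
    have h₂ := congrArg ζ (h.poisson ξ η)
    have h₃ := congrArg ζ (h.concomitant_sections hsep X η)
    have h₄ := congrArg ζ (h.concomitant_sections hsep Y ξ)
    simp only [LieAlgebroid.torsion, LieAlgebroid.halfSchouten, LieAlgebroid.formBracket, two_smul,
      doubleEndo_apply, dorfman, Prod.fst_add, Prod.fst_sub, map_sub, map_add, map_neg, map_zero,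
      μ.add_bracket, μ.bracket_add, μ.neg_bracket, μ.bracket_neg, Derivation.add_apply,
      h.bivector ξ η, h.bivector ζ, h.bivector_map ζ, ← h.map_map,
      LieAlgebroid.lieDeriv_apply, LieAlgebroid.d_apply, LinearMap.neg_apply,
      LinearMap.comp_apply, LinearMap.zero_apply, LinearMap.dualMap_apply,
      μ.bracket_skew (π _) (N Y), μ.bracket_skew (π _) Y, add_zero] at h₁ h₂ h₃ h₄ ⊢
    linear_combination 2 * h₁ + 2 * h₂ + 2 * h₃ - 2 * h₄
  · have h₁ := congrArg η (h.nijenhuis X Z)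
    have h₂ := congrArg ξ (h.nijenhuis Y Z)
    have h₃ := h.concomitant_forms ξ η Z
    simp only [LieAlgebroid.torsion, two_smul,
      doubleEndo_apply, dorfman, Prod.snd_add, Prod.snd_sub, map_sub, map_add, map_neg, map_zero,
      μ.add_bracket, μ.bracket_add, μ.neg_bracket, μ.bracket_neg, Derivation.add_apply,
      Derivation.neg_apply, h.bivector ξ η, h.bivector_map ξ η, ← h.map_map,
      LieAlgebroid.lieDeriv_apply, LieAlgebroid.d_apply, LinearMap.sub_apply, LinearMap.add_apply,
      LinearMap.neg_apply, LinearMap.comp_apply, LinearMap.zero_apply, LinearMap.dualMap_apply,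
      add_zero] at h₁ h₂ h₃ ⊢
    linear_combination -2 * h₁ + 2 * h₂ - 2 * h₃

theorem IsPoissonNijenhuis.isWeakDeforming (h : IsPoissonNijenhuis μ π N)
    (hsep : ∀ X : L, (∀ ξ : Module.Dual R L, ξ X = 0) → X = 0) :
    IsWeakDeforming (pairing R L) μ.toFunction (doubleEndo N π) := by
  -- `𝒩²` itself is symmetric; changing its sign on `A*` gives the skew `S`.
  refine isWeakDeforming_of_deformed_eq μ _ (doubleEndo (N ∘ₗ N) 0)
    (isSkew_doubleEndo h.bivector) (h.deformed_deformed_eq hsep) (fun u => ?_) (fun ξ => ?_)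
  · simp [doubleEndo_apply, h.map_map]
  · refine Prod.ext ?_ (LinearMap.ext fun Z => ?_)
    · simp [doubleEndo_apply, h.map_map]
    · simp [doubleEndo_apply]

end PoissonNijenhuis

/-! ### Forms separate the smooth sections of a vector bundle -/

section Sections

open Bundle

variable {EM : Type*} [NormedAddCommGroup EM] [NormedSpace ℝ EM] [FiniteDimensional ℝ EM]
  {M : Type*} [TopologicalSpace M] [T2Space M] [ChartedSpace EM M] [IsManifold 𝓘(ℝ, EM) ∞ M]
  {F : Type*} [NormedAddCommGroup F] [NormedSpace ℝ F]
  {A : M → Type*} [TopologicalSpace (TotalSpace F A)]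
  [∀ x, TopologicalSpace (A x)] [FiberBundle F A]
  [∀ x, AddCommGroup (A x)] [∀ x, Module ℝ (A x)] [VectorBundle ℝ F A]
  [ContMDiffVectorBundle ∞ F A 𝓘(ℝ, EM)]

/-- The form on a vector bundle that is a continuous linear functional in a local trivialization,
multiplied by a smooth function supported in its domain. -/
noncomputable def cutoffForm (e : Trivialization F (π F A)) [MemTrivializationAtlas e]
    (ℓ : F →L[ℝ] ℝ) (ψ : C^∞⟮𝓘(ℝ, EM), M; 𝓘(ℝ, ℝ), ℝ⟯) (hψ : tsupport ψ ⊆ e.baseSet) :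
    Module.Dual C^∞⟮𝓘(ℝ, EM), M; 𝓘(ℝ, ℝ), ℝ⟯ Cₛ^∞⟮𝓘(ℝ, EM); F, A⟯ where
  toFun s := ⟨fun x => ψ x • ℓ (e.continuousLinearMapAt ℝ x (s x)), by
    -- Only points of the support matter; there the trivialization reads `s` as a smooth map to `F`.
    refine contMDiff_of_tsupport fun x hx => ?_
    have hx' : x ∈ e.baseSet := hψ (tsupport_smul_subset_left _ _ hx)
    have hs := (e.contMDiffAt_section_iff hx').1 (s.contMDiff x)
    refine (ψ.contMDiff x).smul ((ℓ.contMDiff.contMDiffAt.comp x hs).congr_of_eventuallyEq ?_)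
    filter_upwards [e.open_baseSet.mem_nhds hx'] with y hy
    change ℓ (e.linearMapAt ℝ y (s y)) = ℓ _
    rw [e.coe_linearMapAt_of_mem hy]⟩
  map_add' s t := by
    ext x
    change ψ x • ℓ (e.continuousLinearMapAt ℝ x (s x + t x)) = ψ x • ℓ _ + ψ x • ℓ _
    simp only [map_add, smul_add]
  map_smul' f s := by
    ext x
    change ψ x • ℓ (e.continuousLinearMapAt ℝ x (f x • s x)) = f x * (ψ x • ℓ _)
    simp only [map_smul, smul_eq_mul]
    ring

/-- A section annihilated by all forms vanishes. -/
theorem section_eq_zero_of_forall_dual (s : Cₛ^∞⟮𝓘(ℝ, EM); F, A⟯)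
    (hs : ∀ ξ : Module.Dual C^∞⟮𝓘(ℝ, EM), M; 𝓘(ℝ, ℝ), ℝ⟯ Cₛ^∞⟮𝓘(ℝ, EM); F, A⟯, ξ s = 0) :
    s = 0 := by
  ext x
  set e := trivializationAt F A x
  have hx : x ∈ e.baseSet := mem_baseSet_trivializationAt F A x
  obtain ⟨ψ, -, hψ⟩ := ((SmoothBumpFunction.nhds_basis_tsupport (I := 𝓘(ℝ, EM)) x).mem_iff).1
    (e.open_baseSet.mem_nhds hx)
  have h₀ : e.continuousLinearMapAt ℝ x (s x) = 0 := by
    -- Hahn–Banach in the fibre `F`; each functional extends to a global form by a bump function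
    -- equal to `1` at `x`.
    refine (SeparatingDual.eq_zero_iff_forall_dual_eq_zero (R := ℝ) _).2 fun ℓ => ?_
    have := congrArg (fun f => f x) (hs (cutoffForm e ℓ ⟨ψ, ψ.contMDiff⟩ hψ))
    change ψ x • ℓ (e.continuousLinearMapAt ℝ x (s x)) = 0 at this
    rwa [ψ.eq_one, one_smul] at this
  have := e.symmL_continuousLinearMapAt (R := ℝ) hx (s x)
  rw [h₀, map_zero] at this
  exact this.symm

end Sections

end BigBracket

theorem proposition4p7
    {EM : Type*} [NormedAddCommGroup EM] [NormedSpace ℝ EM] [FiniteDimensional ℝ EM]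
    {M : Type u} [TopologicalSpace M] [T2Space M] [SigmaCompactSpace M]
    [ChartedSpace EM M] [IsManifold 𝓘(ℝ, EM) ∞ M]
    {F : Type*} [NormedAddCommGroup F] [NormedSpace ℝ F] [FiniteDimensional ℝ F]
    {A : M → Type u} [TopologicalSpace (Bundle.TotalSpace F A)]
    [∀ x, TopologicalSpace (A x)] [FiberBundle F A]
    [∀ x, AddCommGroup (A x)] [∀ x, Module ℝ (A x)] [VectorBundle ℝ F A]
    [ContMDiffVectorBundle ∞ F A 𝓘(ℝ, EM)]
    (μ : LieAlgebroid C^∞⟮𝓘(ℝ, EM), M; 𝓘(ℝ, ℝ), ℝ⟯ Cₛ^∞⟮𝓘(ℝ, EM); F, A⟯)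
    (N : Cₛ^∞⟮𝓘(ℝ, EM); F, A⟯ →ₗ[C^∞⟮𝓘(ℝ, EM), M; 𝓘(ℝ, ℝ), ℝ⟯] Cₛ^∞⟮𝓘(ℝ, EM); F, A⟯)
    (π : Module.Dual C^∞⟮𝓘(ℝ, EM), M; 𝓘(ℝ, ℝ), ℝ⟯ Cₛ^∞⟮𝓘(ℝ, EM); F, A⟯
      →ₗ[C^∞⟮𝓘(ℝ, EM), M; 𝓘(ℝ, ℝ), ℝ⟯] Cₛ^∞⟮𝓘(ℝ, EM); F, A⟯)
    (hπ : IsBivector π) (hNπ : N ∘ₗ π = π ∘ₗ N.dualMap)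
    (hPN : IsPoissonNijenhuis μ π N) :
    IsCourantStructure (pairing C^∞⟮𝓘(ℝ, EM), M; 𝓘(ℝ, ℝ), ℝ⟯ Cₛ^∞⟮𝓘(ℝ, EM); F, A⟯)
        μ.toFunction ∧
      IsWeakDeforming (pairing C^∞⟮𝓘(ℝ, EM), M; 𝓘(ℝ, ℝ), ℝ⟯ Cₛ^∞⟮𝓘(ℝ, EM); F, A⟯)
        μ.toFunction (doubleEndo N π) :=
  ⟨isCourantStructure_toFunction μ,
    hPN.isWeakDeforming section_eq_zero_of_forall_dual⟩
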